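/- Let $d\ge 3$, let $T_d$ be the $d$-regular tree with vertex set $V(T_d)$ and automorphism group $\Gamma=\mathrm{Aut}(T_d)$, and let $M$ be a measurable space. Let $S$ be either $V(T_d)$ or the set $E(T_d)$ of directed edges of $T_d$ (ordered pairs of adjacent vertices), and let $\mu$ be a probability measure on a measurable space $L$ (for example, $S=V(T_d)$ and $\mu$ the uniform distribution on $[0,1]$). Let $F\colon L^{S}\to M^{V(T_d)}$ be a $\Gamma$-factor, that is, a measurable map (for the product $\sigma$-algebras) with $F(\gamma\cdot\omega)=\gamma\cdot F(\omega)$ for all $\gamma\in\Gamma$ and $\omega\in L^S$, where $(\gamma\cdot f)(s)=f(\gamma^{-1}s)$, and let $\nu=F_*(\mu^{S})$ be the corresponding factor of i.i.d. process on $M^{V(T_d)}$. Then all 1-ended tail $\sigma$-algebras are trivial with respect to $\nu$: for every infinite simple path $(v_0,v_1,v_2,\dots)$ in $T_d$ and every event $$A\in\bigcap_{n\ge 1}\sigma(D_n),\qquad D_n=\{u\in V(T_d):\mathrm{dist}(u,v_n)<\mathrm{dist}(u,v_{n-1})\},$$ where $\sigma(D)$ denotes the $\sigma$-algebra on $M^{V(T_d)}$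 generated by the coordinate projections $\pi_v$, $v\in D$, one has $\nu(A)\in\{0,1\}$. -/

import Mathlib

open MeasureTheory

/-- The automorphism group of a graph `T`, acting on its vertices by `γ • v = γ v`, acts on its
directed edges (ordered pairs of adjacent vertices) by `γ • (u, v) = (γ u, γ v)`. -/
instance SimpleGraph.autDartMulAction {V : Type*} (T : SimpleGraph V) :
    MulAction (T ≃g T) T.Dart where
  smul γ e := ⟨(γ e.fst, γ e.snd), γ.map_rel_iff.2 e.adj⟩
  one_smul _ := rfl
  mul_smul _ _ _ := rfl

/-- The action of a group `Γ` on labellings `f : S → M` of a `Γ`-set `S`: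
`(γ · f) s = f (γ⁻¹ · s)`. -/
def shiftLabel {Γ S M : Type*} [Group Γ] [MulAction Γ S] (γ : Γ) (f : S → M) : S → M :=
  fun s => f (γ⁻¹ • s)

/-- A `Γ`-factor map: a measurable map between spaces of labellings that commutes with the
`Γ`-actions. The spaces of labellings carry the product σ-algebras. -/
structure IsFactorMap (Γ : Type*) [Group Γ] {S₁ S₂ M₁ M₂ : Type*}
    [MulAction Γ S₁] [MulAction Γ S₂] [MeasurableSpace M₁] [MeasurableSpace M₂]
    (F : (S₁ → M₁) → (S₂ → M₂)) : Prop where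
  measurable : Measurable F
  equivariant : ∀ (γ : Γ) (f : S₁ → M₁), F (shiftLabel γ f) = shiftLabel γ (F f)

/-- The law `ν₂` is a `Γ`-factor of the law `ν₁`: it is the push-forward of `ν₁` under some
`Γ`-factor map. -/
def IsFactorOf (Γ : Type*) [Group Γ] {S₁ S₂ M₁ M₂ : Type*}
    [MulAction Γ S₁] [MulAction Γ S₂] [MeasurableSpace M₁] [MeasurableSpace M₂]
    (ν₁ : Measure (S₁ → M₁)) (ν₂ : Measure (S₂ → M₂)) : Prop :=
  ∃ F : (S₁ → M₁) → (S₂ → M₂), IsFactorMap Γ F ∧ ν₂ = ν₁.map F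

/-- The law of the i.i.d. process on `L^S` with marginal `μ`, that is, the product measure. -/
noncomputable def iidLaw (S : Type*) {L : Type*} [MeasurableSpace L] (μ : Measure L)
    [IsProbabilityMeasure μ] : Measure (S → L) :=
  Measure.infinitePi (fun _ : S => μ)

/-- The σ-algebra on `M^V` generated by the coordinate projections `x ↦ x v` with `v ∈ D`. -/
@[reducible] def coordSigma {V : Type*} (M : Type*) [MeasurableSpace M] (D : Set V) :
    MeasurableSpace (V → M) :=
  ⨆ v ∈ D, MeasurableSpace.comap (fun x : V → M => x v) inferInstance

/-- `p 0, p 1, p 2, …` is an infinite simple path in `T`. -/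
structure IsInfiniteSimplePath {V : Type*} (T : SimpleGraph V) (p : ℕ → V) : Prop where
  adj : ∀ n, T.Adj (p n) (p (n + 1))
  injective : Function.Injective p

/-- The vertices that are closer to `p n` than to `p (n - 1)`; meant for `1 ≤ n`. -/
def beyondSet {V : Type*} (T : SimpleGraph V) (p : ℕ → V) (n : ℕ) : Set V :=
  {u | T.dist u (p n) < T.dist u (p (n - 1))}

/-- The 1-ended tail σ-algebra on `M^V` corresponding to the infinite simple path `p`. -/
@[reducible] def oneEndedTail {V : Type*} (M : Type*) [MeasurableSpace M] (T : SimpleGraph V) (p : ℕ → V) :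
    MeasurableSpace (V → M) :=
  ⨅ n ≥ 1, coordSigma M (beyondSet T p n)

/-- A σ-algebra `m` is trivial with respect to `ν` if all its members have measure `0` or `1`. -/
def IsTrivialSigma {Ω : Type*} (m : MeasurableSpace Ω) {m₀ : MeasurableSpace Ω}
    (ν : Measure Ω) : Prop :=
  ∀ A : Set Ω, MeasurableSet[m] A → ν A = 0 ∨ ν A = 1

/-! Let `A` be a tail event and `B` its preimage under `F`. Given a finite set `I` of vertices, the
ray `p` eventually moves away from all of `I`, so `I` lies in one branch at some vertex `r` of the
ray, and the ray leaves `r` through another branch. As `d ≥ 3`, there is a third branch, and an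
automorphism `γ` can swap it with the one containing `I`, fixing the ray's branch
(`exists_iso_fix_beyondSet`). Since `A` depends only on coordinates in the fixed branch,
equivariance makes `B` invariant under `γ`, although `γ` moves `I` off itself. The usual mixing
argument then gives `P(B) = P(B)²` (`iidLaw_eq_zero_or_one`). -/

open scoped symmDiff in
/-- An event of an i.i.d. process that is invariant under permutations of the index set moving
any given finite set off itself has probability `0` or `1`. -/
theorem iidLaw_eq_zero_or_one {S L : Type*} [MeasurableSpace L] (μ : Measure L)
    [IsProbabilityMeasure μ] {B : Set (S → L)} (hB : MeasurableSet B)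
    (h : ∀ I : Finset S, ∃ e : S ≃ S, (∀ s ∈ I, e s ∉ I) ∧
      (fun (ω : S → L) s => ω (e s)) ⁻¹' B = B) :
    iidLaw S μ B = 0 ∨ iidLaw S μ B = 1 := by
  classical
  set P := iidLaw S μ with hP
  have : IsProbabilityMeasure P := by rw [hP, iidLaw]; infer_instance
  -- With `b = P(B)` and `c = P(C)` for a cylinder `C` that is `ε`-close to `B`: `|b - c²| ≤ 2ε` by
  -- independence, and `|c² - b²| ≤ 2|c - b| ≤ 2ε`.
  have key : ∀ ε : ℝ, 0 < ε → |P.real B - P.real B * P.real B| ≤ 4 * ε := by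
    intro ε hε
    obtain ⟨C, hC, hCB⟩ := exists_measure_symmDiff_lt_of_generateFrom_isSetRing (μ := P)
      (C := measurableCylinders fun _ : S => L) isSetRing_measurableCylinders
      ⟨{Set.univ}, Set.countable_singleton _, by simpa using univ_mem_measurableCylinders (fun _ : S => L),
        by simp⟩
      generateFrom_measurableCylinders.symm hB (ENNReal.ofReal_pos.2 hε)
    have hCm : MeasurableSet C := .of_mem_measurableCylinders hC
    obtain ⟨I, U, hU, rfl⟩ := (mem_measurableCylinders _).1 hC
    obtain ⟨e, heI, heB⟩ := h I
    set θ : (S → L) → (S → L) := fun ω s => ω (e s) with hθ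
    set C := cylinder (α := fun _ : S => L) I U with hCdef
    have hmp : MeasurePreserving θ P P :=
      ⟨by fun_prop, Measure.map_infinitePi_infinitePi_of_inj e.injective⟩
    have hC' : MeasurableSet (θ ⁻¹' C) := hmp.measurable hCm
    -- `C` depends on the coordinates in `I`, its preimage on those in `e(I)`, which is disjoint
    -- from `I`.
    have hindep : P.real (C ∩ θ ⁻¹' C) = P.real C * P.real C := by
      have hi : ProbabilityTheory.iIndepFun (fun (i : S) (ω : S → L) => ω i) P :=
        ProbabilityTheory.iIndepFun_infinitePi (X := fun _ x => x) (fun _ => measurable_id)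
      have hd : Disjoint I (I.map e.toEmbedding) := by
        rw [Finset.disjoint_right]
        intro s hs
        obtain ⟨t, ht, rfl⟩ := Finset.mem_map.1 hs
        exact heI t ht
      have h2 := (hi.indepFun_finset I (I.map e.toEmbedding) hd (fun i => by fun_prop)).comp
        (φ := id) (ψ := fun x (i : I) => x ⟨e i, Finset.mem_map_of_mem _ i.2⟩)
        measurable_id (by fun_prop)
      have h3 := h2.measure_inter_preimage_eq_mul U U hU hU
      have h4 : P (C ∩ θ ⁻¹' C) = P C * P (θ ⁻¹' C) := h3
      rw [hmp.measure_preimage hCm.nullMeasurableSet] at h4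
      simp [Measure.real, h4]
    have hd1 : P.real (B ∆ C) ≤ ε := by
      rw [symmDiff_comm]
      exact ENNReal.toReal_le_of_le_ofReal hε.le hCB.le
    have hd2 : P.real (B ∆ (θ ⁻¹' C)) ≤ ε := by
      have : B ∆ (θ ⁻¹' C) = θ ⁻¹' (B ∆ C) := by
        conv_lhs => rw [← heB]
        rfl
      rw [this, Measure.real, hmp.measure_preimage (hB.symmDiff hCm).nullMeasurableSet]
      exact hd1
    have hd3 : P.real (B ∆ (C ∩ θ ⁻¹' C)) ≤ 2 * ε := by
      calc P.real (B ∆ (C ∩ θ ⁻¹' C)) ≤ P.real (B ∆ C ∪ B ∆ (θ ⁻¹' C)) := by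
            refine measureReal_mono ?_ (measure_ne_top _ _)
            intro x
            simp only [Set.mem_symmDiff, Set.mem_union, Set.mem_inter_iff]
            tauto
        _ ≤ P.real (B ∆ C) + P.real (B ∆ (θ ⁻¹' C)) := measureReal_union_le _ _
        _ ≤ 2 * ε := by linarith
    have h1 := (abs_measureReal_sub_le_measureReal_symmDiff (μ := P) hB.nullMeasurableSet
      hCm.nullMeasurableSet).trans hd1
    have h2 := (abs_measureReal_sub_le_measureReal_symmDiff (μ := P) hB.nullMeasurableSet
      (hCm.inter hC').nullMeasurableSet).trans hd3
    rw [hindep] at h2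
    have b0 : 0 ≤ P.real B := measureReal_nonneg
    have b1 : P.real B ≤ 1 := measureReal_le_one
    have c0 : 0 ≤ P.real C := measureReal_nonneg
    have c1 : P.real C ≤ 1 := measureReal_le_one
    rw [abs_le] at *
    constructor <;> nlinarith
  have hz : P.real B - P.real B * P.real B = 0 := by
    rw [← abs_eq_zero]
    refine le_antisymm (le_of_forall_pos_le_add fun ε hε => ?_) (abs_nonneg _)
    have := key (ε / 4) (by positivity)
    linarith
  have : P.real B * (1 - P.real B) = 0 := by linarith
  rcases mul_eq_zero.1 this with h0 | h1
  · left
    simpa [Measure.real, ENNReal.toReal_eq_zero_iff] using h0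
  · right
    have : (P B).toReal = 1 := by simpa [Measure.real] using (sub_eq_zero.1 h1).symm
    exact (ENNReal.toReal_eq_one_iff _).1 this

/-! ### Tail events of factors -/

theorem coordSigma_le {V : Type*} (M : Type*) [MeasurableSpace M] (D : Set V) :
    coordSigma M D ≤ MeasurableSpace.pi :=
  iSup₂_le fun v _ => (measurable_pi_apply v).comap_le

/-- Whether an event of `coordSigma M D` occurs is determined by the coordinates in `D`. -/
theorem mem_iff_of_measurableSet_coordSigma {V M : Type*} [MeasurableSpace M] {D : Set V}
    {A : Set (V → M)} (hA : MeasurableSet[coordSigma M D] A) {f g : V → M}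
    (hfg : ∀ v ∈ D, f v = g v) : f ∈ A ↔ g ∈ A := by
  -- Only factoring through the restriction to `D` matters, so `⊤` suffices as the σ-algebra there.
  have hle : coordSigma M D ≤ MeasurableSpace.comap (fun (x : V → M) (v : D) => x v) ⊤ := by
    refine iSup₂_le fun v hv => ?_
    rintro _ ⟨t, -, rfl⟩
    exact ⟨{y | y ⟨v, hv⟩ ∈ t}, trivial, rfl⟩
  obtain ⟨t, -, rfl⟩ := hle A hA
  have : (fun v : D => f v) = fun v : D => g v := funext fun v => hfg v v.2
  simp only [Set.mem_preimage, this]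

/-- If some group elements fix a set `beyondSet T p n` pointwise and move a given finite set off
itself, then the 1-ended tail of a factor of an i.i.d. process is trivial. -/
theorem IsFactorOf.isTrivialSigma_oneEndedTail {Γ S V M L : Type*} [Group Γ] [MulAction Γ S]
    [MulAction Γ V] [MeasurableSpace M] [MeasurableSpace L] {μ : Measure L}
    [IsProbabilityMeasure μ] {ν : Measure (V → M)} (hν : IsFactorOf Γ (iidLaw S μ) ν)
    {T : SimpleGraph V} {p : ℕ → V}
    (h : ∀ I : Finset S, ∃ n ≥ 1, ∃ γ : Γ, (∀ u ∈ beyondSet T p n, γ • u = u) ∧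
      ∀ s ∈ I, γ • s ∉ I) :
    IsTrivialSigma (oneEndedTail M T p) ν := by
  intro A hA
  obtain ⟨F, hF, rfl⟩ := hν
  have hAn : ∀ n ≥ 1, MeasurableSet[coordSigma M (beyondSet T p n)] A := fun n hn =>
    (iInf₂_le (f := fun n (_ : n ≥ 1) => coordSigma M (beyondSet T p n)) n hn) A hA
  have hAm : MeasurableSet A := coordSigma_le M _ A (hAn 1 le_rfl)
  rw [Measure.map_apply hF.measurable hAm]
  refine iidLaw_eq_zero_or_one μ (hF.measurable hAm) fun I => ?_
  obtain ⟨n, hn, γ, hfix, hmove⟩ := h I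
  refine ⟨MulAction.toPerm γ, hmove, ?_⟩
  ext ω
  have hω : (fun s => ω (MulAction.toPerm γ s)) = shiftLabel γ⁻¹ ω := by
    ext s
    simp [shiftLabel]
  rw [Set.mem_preimage, Set.mem_preimage, Set.mem_preimage, hω, hF.equivariant]
  refine mem_iff_of_measurableSet_coordSigma (hAn n hn) fun v hv => ?_
  simp [shiftLabel, hfix v hv]

/-! ### Rooted trees and extension of automorphisms -/

namespace SimpleGraph

variable {V : Type*} {T : SimpleGraph V}

theorem Connected.exists_adj_dist_eq_add_one (hT : T.Connected) {r u : V} (hu : u ≠ r) :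
    ∃ w, T.Adj w u ∧ T.dist r u = T.dist r w + 1 := by
  obtain ⟨q, -, hq⟩ := hT.exists_path_of_dist u r
  cases q with
  | nil => exact absurd rfl hu
  | @cons _ w _ h q =>
    refine ⟨w, h.symm, ?_⟩
    rw [Walk.length_cons] at hq
    have h1 := dist_le q
    have h2 := h.diff_dist_adj (u := r)
    rw [dist_comm] at h1 hq
    omega

/-- In a tree, a vertex has at most one neighbour closer to a given root. -/
theorem IsTree.eq_of_adj_of_dist_lt (hT : T.IsTree) {r u w w' : V} (hw : T.Adj w u)
    (hw' : T.Adj w' u) (h : T.dist r w < T.dist r u) (h' : T.dist r w' < T.dist r u) :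
    w = w' := by
  have key : ∀ {w : V} (hw : T.Adj w u), T.dist r w < T.dist r u →
      ∃ q : T.Walk r w, (q.concat hw).IsPath := by
    intro w hw h
    obtain ⟨q, -, hq⟩ := hT.connected.exists_path_of_dist r w
    -- A geodesic to `w` extended to `u` is again a geodesic; uniqueness of paths then forces equal
    -- penultimate vertices.
    refine ⟨q, Walk.isPath_of_length_eq_dist _ ?_⟩
    have := hT.dist_eq_dist_add_one_of_adj r hw
    rw [Walk.length_concat, hq]
    omega
  obtain ⟨q, hq⟩ := key hw h
  obtain ⟨q', hq'⟩ := key hw' h'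
  have := (hT.existsUnique_path r u).unique hq hq'
  have h2 := congrArg Walk.penultimate this
  simpa using h2

/-- Recursion along a parent function. -/
theorem exists_recursion_along_parent (dist : V → ℕ) (par : V → V) (σ : V → V)
    (step : V → V → V) (hpar : ∀ u, 2 ≤ dist u → dist u = dist (par u) + 1) :
    ∃ γ : V → V, (∀ u, dist u ≤ 1 → γ u = σ u) ∧
      ∀ u, 2 ≤ dist u → γ u = step (γ (par u)) u := by
  -- Truncated subtraction in `dist u - 1` puts the root and its neighbours together at level `0`.
  let f : ℕ → V → V := fun n => Nat.rec σ (fun _ g u => step (g (par u)) u) n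
  refine ⟨fun u => f (dist u - 1) u, fun u hu => ?_, fun u hu => ?_⟩
  · have : dist u - 1 = 0 := by omega
    simp only [this]
    rfl
  · have h := hpar u hu
    have : dist u - 1 = (dist (par u) - 1) + 1 := by omega
    simp only [this]
    rfl

/-- In a regular tree with root `r`, the children of every vertex other than `r` can be indexed
by a common index type. -/
theorem IsTree.exists_child_index (hT : T.IsTree) [T.LocallyFinite] {d : ℕ} (hd : 2 ≤ d)
    (hreg : T.IsRegularOfDegree d) (r : V) (par : V → V)
    (hadj : ∀ u, u ≠ r → T.Adj (par u) u)
    (hdist : ∀ u, u ≠ r → T.dist r u = T.dist r (par u) + 1) :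
    ∃ (idx : V → Fin (d - 1)) (child : V → Fin (d - 1) → V),
      (∀ w, w ≠ r → ∀ i, T.Adj w (child w i) ∧ T.dist r (child w i) = T.dist r w + 1 ∧
        idx (child w i) = i) ∧
      ∀ v, 2 ≤ T.dist r v → child (par v) (idx v) = v := by
  classical
  let ch : V → Finset V := fun w => (T.neighborFinset w).erase (par w)
  have hch : ∀ w, w ≠ r → ∀ v, v ∈ ch w ↔ T.Adj w v ∧ T.dist r v = T.dist r w + 1 := by
    intro w hw v
    simp only [ch, Finset.mem_erase, mem_neighborFinset]
    constructor
    · rintro ⟨hv, hwv⟩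
      refine ⟨hwv, ?_⟩
      rcases hT.dist_eq_dist_add_one_of_adj r hwv with h | h
      · exact absurd (hT.eq_of_adj_of_dist_lt hwv.symm (hadj w hw) (r := r) (by omega)
          (by have := hdist w hw; omega)) hv
      · exact h
    · rintro ⟨hwv, h⟩
      refine ⟨?_, hwv⟩
      rintro rfl
      have := hdist w hw
      omega
  have hcard : ∀ w, w ≠ r → (ch w).card = d - 1 := by
    intro w hw
    rw [Finset.card_erase_of_mem ((mem_neighborFinset _ _ _).2 (hadj w hw).symm),
      card_neighborFinset_eq_degree, hreg w]
  have hdpos : 0 < d - 1 := by omega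
  have hne : ∀ v, 2 ≤ T.dist r v → v ≠ r ∧ par v ≠ r := by
    intro v hv
    have hvr : v ≠ r := by rintro rfl; simp at hv
    refine ⟨hvr, fun h => ?_⟩
    have := hdist v hvr
    rw [h, dist_self] at this
    omega
  have hmem : ∀ v, 2 ≤ T.dist r v → v ∈ ch (par v) := fun v hv =>
    (hch _ (hne v hv).2 v).2 ⟨hadj v (hne v hv).1, hdist v (hne v hv).1⟩
  let e : ∀ w, w ≠ r → (ch w ≃ Fin (d - 1)) := fun w hw =>
    (ch w).equivFinOfCardEq (hcard w hw)
  let idx : V → Fin (d - 1) := fun v =>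
    if hv : 2 ≤ T.dist r v then e (par v) (hne v hv).2 ⟨v, hmem v hv⟩ else ⟨0, hdpos⟩
  let child : V → Fin (d - 1) → V := fun w i =>
    if hw : w ≠ r then ((e w hw).symm i : V) else w
  refine ⟨idx, child, fun w hw i => ?_, fun v hv => ?_⟩
  · have h1 : child w i = ((e w hw).symm i : V) := dif_pos hw
    have h2 := (hch w hw _).1 ((e w hw).symm i).2
    rw [← h1] at h2
    refine ⟨h2.1, h2.2, ?_⟩
    have hpos : 0 < T.dist r w := hT.connected.pos_dist_of_ne hw.symm
    have h3 : 2 ≤ T.dist r (child w i) := by omega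
    have h4 : par (child w i) = w := hT.eq_of_adj_of_dist_lt (hadj _ (hne _ h3).1) h2.1 (r := r)
      (by have := hdist _ (hne _ h3).1; omega) (by omega)
    -- Generalizing `w'` and `v` allows substitution in the dependent arguments of `e`.
    have h5 : ∀ (w' : V) (hw' : w' ≠ r) (v : V) (hv : v ∈ ch w'), w' = w → v = child w i →
        e w' hw' ⟨v, hv⟩ = i := by
      rintro w' hw' v hv rfl rfl
      rw [← Equiv.eq_symm_apply]
      exact Subtype.ext h1
    simp only [idx, dif_pos h3]
    exact h5 _ (hne _ h3).2 _ (hmem _ h3) h4 rfl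
  · simp only [child, idx, dif_pos hv, dif_pos (hne v hv).2, Equiv.symm_apply_apply]

/-- In a regular tree, there is an automorphism that swaps two neighbours `a`, `b` of `r` and
fixes all branches at `r` other than those of `a` and `b`. -/
theorem IsTree.exists_iso_swap_branches (hT : T.IsTree) [T.LocallyFinite] {d : ℕ} (hd : 2 ≤ d)
    (hreg : T.IsRegularOfDegree d) {r a b : V} (ha : T.Adj r a) (hb : T.Adj r b) :
    ∃ γ : T ≃g T, γ r = r ∧ γ a = b ∧ ∀ c, T.Adj r c → c ≠ a → c ≠ b →
      ∀ u, T.dist u c < T.dist u r → γ u = u := by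
  classical
  have hpar : ∀ u, ∃ w, u ≠ r → T.Adj w u ∧ T.dist r u = T.dist r w + 1 := by
    intro u
    by_cases hu : u = r
    · exact ⟨u, fun h => absurd hu h⟩
    · obtain ⟨w, hw⟩ := hT.connected.exists_adj_dist_eq_add_one hu
      exact ⟨w, fun _ => hw⟩
  choose par hpar using hpar
  have hadj := fun u hu => (hpar u hu).1
  have hdist := fun u hu => (hpar u hu).2
  have hne : ∀ u n, n + 1 ≤ T.dist r u → u ≠ r := by
    rintro u n h rfl
    simp at h
  have hparu : ∀ w u, T.Adj w u → T.dist r u = T.dist r w + 1 → par u = w := by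
    intro w u hwu h
    have hu := hne u _ h.ge
    exact hT.eq_of_adj_of_dist_lt (r := r) (hadj u hu) hwu (by have := hdist u hu; omega)
      (by omega)
  obtain ⟨idx, child, hchild, hidx⟩ := hT.exists_child_index hd hreg r par hadj hdist
  -- `γ` swaps `a` and `b` near the root; further out it sends `u` to the child of `γ (par u)` with
  -- the index of `u`. Keeping the index makes `γ` an involution.
  obtain ⟨γ, hγ1, hγ2⟩ := exists_recursion_along_parent (T.dist r) par (Equiv.swap a b)
    (fun w u => child w (idx u)) (fun u hu => hdist u (hne u 1 hu))
  have hra : r ≠ a := ha.ne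
  have hrb : r ≠ b := hb.ne
  have hγr : γ r = r := by
    rw [hγ1 r (by simp), Equiv.swap_apply_of_ne_of_ne hra hrb]
  have hone : ∀ u, T.dist r u = 1 ↔ T.Adj r u := fun u => dist_eq_one_iff_adj
  have hσ : ∀ u, T.Adj r u → T.Adj r (Equiv.swap a b u) := by
    intro u hu
    by_cases h1 : u = a
    · rw [h1, Equiv.swap_apply_left]; exact hb
    by_cases h2 : u = b
    · rw [h2, Equiv.swap_apply_right]; exact ha
    rwa [Equiv.swap_apply_of_ne_of_ne h1 h2]
  have hdepth : ∀ n u, T.dist r u = n → T.dist r (γ u) = n := by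
    intro n
    induction n with
    | zero =>
      intro u hu
      rw [← hT.connected.dist_eq_zero_iff.1 hu, hγr, dist_self]
    | succ n ih =>
      intro u hu
      rcases Nat.eq_zero_or_pos n with rfl | hn
      · rw [hγ1 u hu.le]
        exact (hone _).2 (hσ u ((hone u).1 hu))
      · have h1 := hdist u (hne u n hu.ge)
        have h2 := ih (par u) (by omega)
        rw [hγ2 u (by omega), (hchild _ (hne _ (n - 1) (by omega)) _).2.1, h2]
  have hstep : ∀ u, 2 ≤ T.dist r u → γ (par u) ≠ r := by
    intro u hu
    have h1 := hdist u (hne u 1 hu)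
    exact hne _ 0 (by rw [hdepth _ _ rfl]; omega)
  have hγpar : ∀ u, 2 ≤ T.dist r u → par (γ u) = γ (par u) := by
    intro u hu
    have h := hchild _ (hstep u hu) (idx u)
    rw [← hγ2 u hu] at h
    exact hparu _ _ h.1 h.2.1
  have hinv : ∀ n u, T.dist r u = n → γ (γ u) = u := by
    intro n
    induction n with
    | zero =>
      intro u hu
      rw [← hT.connected.dist_eq_zero_iff.1 hu, hγr, hγr]
    | succ n ih =>
      intro u hu
      rcases Nat.eq_zero_or_pos n with rfl | hn
      · rw [hγ1 _ (hdepth _ u hu).le, hγ1 u hu.le, Equiv.swap_apply_self]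
      · have h1 := hdist u (hne u n hu.ge)
        have h2 : 2 ≤ T.dist r u := by omega
        have h3 : idx (γ u) = idx u := by
          rw [hγ2 u h2]
          exact (hchild _ (hstep u h2) _).2.2
        rw [hγ2 (γ u) (by rw [hdepth _ u rfl]; exact h2), hγpar u h2, h3,
          ih (par u) (by omega), hidx u h2]
  have hmap1 : ∀ w u, T.Adj w u → T.dist r u = T.dist r w + 1 → T.Adj (γ w) (γ u) := by
    intro w u hwu h
    rcases Nat.eq_zero_or_pos (T.dist r w) with h0 | h0
    · have hw : w = r := (hT.connected.dist_eq_zero_iff.1 h0).symm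
      subst hw
      rw [hγr, hγ1 u (by omega)]
      exact hσ u hwu
    · have h2 : 2 ≤ T.dist r u := by omega
      rw [hγ2 u h2, hparu w u hwu h]
      exact (hchild _ (by rw [← hparu w u hwu h]; exact hstep u h2) _).1
  have hmap : ∀ w u, T.Adj w u → T.Adj (γ w) (γ u) := by
    intro w u hwu
    rcases hT.dist_eq_dist_add_one_of_adj r hwu with h | h
    · exact (hmap1 u w hwu.symm h).symm
    · exact hmap1 w u hwu h
  have hinvol : Function.Involutive γ := fun u => hinv _ u rfl
  refine ⟨⟨hinvol.toPerm γ, fun {w u} => ⟨fun h => ?_, hmap w u⟩⟩, hγr, ?_, ?_⟩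
  · have := hmap _ _ h
    simpa only [Function.Involutive.coe_toPerm, hinvol w, hinvol u] using this
  · change γ a = b
    rw [hγ1 a ((hone a).2 ha).le, Equiv.swap_apply_left]
  · intro c hc hca hcb u hu
    change γ u = u
    -- Within the branch of `c`, the neighbour of `u` towards `c` is also its parent with respect to
    -- `r`; once that parent is fixed, so is its child with the index of `u`.
    induction hn : T.dist r u generalizing u with
    | zero =>
      rw [dist_comm (u := u) (v := r), hn] at hu
      omega
    | succ n ih =>
      have hcu : T.dist u c ≤ n := by
        rw [dist_comm (u := u) (v := r)] at hu
        omega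
      by_cases huc : u = c
      · subst huc
        rw [hγ1 u ((hone u).2 hc).le, Equiv.swap_apply_of_ne_of_ne hca hcb]
      · obtain ⟨w, hw, hwd⟩ := hT.connected.exists_adj_dist_eq_add_one (r := c) huc
        have e1 := hT.connected.dist_triangle (u := r) (v := c) (w := w)
        have e2 := hT.dist_eq_dist_add_one_of_adj r hw
        have e3 := (hone c).2 hc
        rw [dist_comm (u := u) (v := c)] at hcu
        have e4 : T.dist r u = T.dist r w + 1 := by omega
        have hpu := hparu w u hw e4
        have e5 : γ w = w := ih w (by rw [dist_comm (u := w) (v := c), dist_comm (u := w) (v := r)]; omega) (by omega)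
        have hpos := hT.connected.pos_dist_of_ne (Ne.symm huc)
        have e6 := hT.connected.dist_triangle (u := r) (v := w) (w := u)
        have e7 : w ≠ r := by
          rintro rfl
          have h9 : T.dist c u < T.dist c w := by
            rw [dist_comm (u := c) (v := w), e3]
            rw [dist_self] at e4
            omega
          omega
        have hwpos := hT.connected.pos_dist_of_ne e7.symm
        have h2 : 2 ≤ T.dist r u := by omega
        rw [hγ2 u h2, hpu, e5, ← hpu, hidx u h2]

/-! ### Rays and half-trees -/

/-- A ray in a tree eventually moves away from every vertex. -/
theorem IsTree.exists_forall_ge_dist_lt (hT : T.IsTree) {p : ℕ → V}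
    (hp : IsInfiniteSimplePath T p) (u : V) :
    ∃ N, ∀ n ≥ N, T.dist u (p n) < T.dist u (p (n + 1)) := by
  -- Turning back would make `p n` and `p (n + 2)` both closer neighbours of `p (n + 1)`, hence
  -- equal.
  have hstep : ∀ n, T.dist u (p n) < T.dist u (p (n + 1)) →
      T.dist u (p (n + 1)) < T.dist u (p (n + 1 + 1)) := by
    intro n h
    by_contra h'
    have h2 := hT.dist_eq_dist_add_one_of_adj u (hp.adj (n + 1))
    have := hp.injective (hT.eq_of_adj_of_dist_lt (hp.adj n) (hp.adj (n + 1)).symm h (by omega))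
    omega
  have hex : ∃ N, T.dist u (p N) < T.dist u (p (N + 1)) := by
    by_contra! h
    have : ∀ n, T.dist u (p n) + n ≤ T.dist u (p 0) := by
      intro n
      induction n with
      | zero => simp
      | succ n ih =>
        have h1 := h n
        have h2 := hT.dist_eq_dist_add_one_of_adj u (hp.adj n)
        omega
    have := this (T.dist u (p 0) + 1)
    omega
  obtain ⟨N, hN⟩ := hex
  refine ⟨N, fun n hn => ?_⟩
  induction n, hn using Nat.le_induction with
  | base => exact hN
  | succ n _ ih => exact hstep n ih

theorem Iso.dist_eq (γ : T ≃g T) (u v : V) : T.dist (γ u) (γ v) = T.dist u v := by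
  have key : ∀ (γ : T ≃g T) (u v : V), T.edist (γ u) (γ v) ≤ T.edist u v := by
    intro γ u v
    refine le_iInf fun q => ?_
    simpa using edist_le (q.map γ.toHom)
  refine congrArg ENat.toNat (le_antisymm (key γ u v) ?_)
  simpa using key γ.symm (γ u) (γ v)

/-- In a regular tree of degree at least `3`, some automorphism fixes pointwise a half-tree along
a given ray and moves a given finite set off itself. -/
theorem IsTree.exists_iso_fix_beyondSet (hT : T.IsTree) [T.LocallyFinite] {d : ℕ} (hd : 3 ≤ d)
    (hreg : T.IsRegularOfDegree d) {p : ℕ → V} (hp : IsInfiniteSimplePath T p) (I : Finset V) :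
    ∃ n ≥ 1, ∃ γ : T ≃g T, (∀ u ∈ beyondSet T p n, γ u = u) ∧ ∀ u ∈ I, γ u ∉ I := by
  classical
  choose N hN using hT.exists_forall_ge_dist_lt hp
  -- Every vertex of `I` is now in the branch of `p m` at `p (m + 1)`; `b` starts a branch off the
  -- ray.
  set m := I.sup N
  have hcard : ({p m, p (m + 2)} : Finset V).card < (T.neighborFinset (p (m + 1))).card := by
    rw [card_neighborFinset_eq_degree, hreg]
    exact Finset.card_le_two.trans_lt hd
  obtain ⟨b, hb, hb'⟩ := Finset.exists_mem_notMem_of_card_lt_card hcard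
  simp only [Finset.mem_insert, Finset.mem_singleton, not_or] at hb'
  rw [mem_neighborFinset] at hb
  obtain ⟨γ, hγr, hγa, hγ⟩ :=
    hT.exists_iso_swap_branches (by omega) hreg (hp.adj m).symm hb
  refine ⟨m + 2, by omega, γ, fun u hu => hγ (p (m + 2)) (hp.adj (m + 1)) ?_ (Ne.symm hb'.2) u hu,
    fun u hu hγu => ?_⟩
  · exact fun h => by have := hp.injective h; omega
  · have h1 := hN u m (Finset.le_sup hu)
    have h2 := hN (γ u) m (Finset.le_sup hγu)
    -- Transported by `γ`, `h1` puts `γ u` in the branch of `b`, while `h2` puts it in that of `p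
    -- m`.
    rw [← Iso.dist_eq γ u, ← Iso.dist_eq γ u (p (m + 1)), hγr, hγa] at h1
    exact hb'.1 (hT.eq_of_adj_of_dist_lt hb.symm (hp.adj m) h1 h2)

end SimpleGraph

theorem mainTheorem4 {V M L : Type*} [MeasurableSpace M] [MeasurableSpace L]
    (d : ℕ) (hd : 3 ≤ d)
    (T : SimpleGraph V) [T.LocallyFinite] (hT : T.IsTree) (hreg : T.IsRegularOfDegree d)
    (μ : Measure L) [IsProbabilityMeasure μ] (ν : Measure (V → M))
    (hν : IsFactorOf (T ≃g T) (iidLaw V μ) ν ∨ IsFactorOf (T ≃g T) (iidLaw T.Dart μ) ν)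
    (p : ℕ → V) (hp : IsInfiniteSimplePath T p) :
    IsTrivialSigma (oneEndedTail M T p) ν := by
  rcases hν with hν | hν
  · exact hν.isTrivialSigma_oneEndedTail fun I => hT.exists_iso_fix_beyondSet hd hreg hp I
  · classical
    refine hν.isTrivialSigma_oneEndedTail fun I => ?_
    -- Moving the set of sources off itself is enough to move the darts off themselves.
    obtain ⟨n, hn, γ, hfix, hmove⟩ :=
      hT.exists_iso_fix_beyondSet hd hreg hp (I.image fun e => e.fst)
    exact ⟨n, hn, γ, hfix, fun e he hγe => hmove e.fst (Finset.mem_image_of_mem _ he)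
      (Finset.mem_image_of_mem (fun e : T.Dart => e.fst) hγe)⟩
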